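/- An algebraic computation tree over $\mathbb R$ works on real registers; each of its nodes either performs one exact operation $+,-,\times,/$ on registers or real constants and stores the result in a register (a *flop*; division by $0$ makes the output undefined), or compares a register or a constant with $0$ and branches according to whether it is $\ge 0$ (a *comparison*), or is a leaf that outputs a natural number. Its numbers of flops and of comparisons are the maxima over all root-to-leaf paths. There is an absolute constant $C$ such that for all integers $n\ge 1$ and $h\ge 1$ there is an algebraic computation tree $T$ with at most $C\,h\,n\log(n+1)$ flops and at most $C\,n$ comparisons of real numbers with $0$ with the following property. Let $p(x)=\sum_{i=0}^n p_ix^i$ be any polynomial with real coefficients and $p_n\ne 0$ for which the unit disc $D(0,1)=\{x\in\mathbb C:|x|\le 1\}$ is $s$-isolated with $s=9^{1/2^h}$, that is, every complex root $x$ of $p$ with $|x|\le s$ satisfies $|x|\le 1$. Then $T$, applied to the input $(p_0,\dots,p_n)$, is defined and outputs the number of complex roots of $p$, counted with multiplicity, in $D(0,1)$. (Thus $O(hn\log n)$ flops and $O(n)$ comparisons of real numbers with $0$ suffice.) -/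

import Mathlib

open Polynomial

/-- The disc `D(c, r)` (closed) is `γ`-isolated for `p` if it contains all complex roots of `p`
that lie in the concentric disc `D(c, γ r)`. -/
def IsIsolatedDisc (p : ℝ[X]) (γ : ℝ) (c : ℂ) (r : ℝ) : Prop :=
  ∀ z : ℂ, aeval z p = 0 → z ∈ Metric.closedBall c (γ * r) → z ∈ Metric.closedBall c r

open Classical in
/-- The number of complex roots of `p`, counted with multiplicity, in the closed disc `D(c, r)`. -/
noncomputable def rootCount (p : ℝ[X]) (c : ℂ) (r : ℝ) : ℕ :=
  (p.aroots ℂ).countP (fun z => z ∈ Metric.closedBall c r)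

/-- The four arithmetic operations. -/
inductive ArithOp
  | add
  | sub
  | mul
  | div

/-- The exact result of an arithmetic operation; division by zero is undefined. -/
noncomputable def ArithOp.apply : ArithOp → ℝ → ℝ → Option ℝ
  | .add, x, y => some (x + y)
  | .sub, x, y => some (x - y)
  | .mul, x, y => some (x * y)
  | .div, x, y => open Classical in if y = 0 then none else some (x / y)

/-- An operand is the current content of a register or a real constant. -/
inductive Operand
  | reg (i : ℕ)
  | const (c : ℝ)

/-- The value of an operand when the registers hold `m`. -/
def Operand.val (m : ℕ → ℝ) : Operand → ℝ
  | .reg i => m i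
  | .const c => c

/-- Algebraic computation trees over `ℝ` whose leaves are labelled with natural numbers.
`arith d o a b t` stores `a o b` in register `d` and continues with `t`;
`branch a t u` compares the real number `a` with `0` and continues with `t` if `0 ≤ a`
and with `u` otherwise; `leaf k` stops with output `k`. -/
inductive CompTree
  | leaf (k : ℕ)
  | arith (d : ℕ) (o : ArithOp) (a b : Operand) (t : CompTree)
  | branch (a : Operand) (t u : CompTree)

namespace CompTree

/-- The output of a tree on the register contents `m`; it is `none` if the computation
divides by zero. -/
noncomputable def run : CompTree → (ℕ → ℝ) → Option ℕ
  | leaf k, _ => some k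
  | arith d o a b t, m =>
      (o.apply (a.val m) (b.val m)).bind fun x => t.run (Function.update m d x)
  | branch a t u, m => open Classical in if 0 ≤ a.val m then t.run m else u.run m

/-- The largest number of arithmetic operations (flops) on a path from the root to a leaf. -/
def flops : CompTree → ℕ
  | leaf _ => 0
  | arith _ _ _ _ t => t.flops + 1
  | branch _ t u => max t.flops u.flops

/-- The largest number of comparisons with `0` on a path from the root to a leaf. -/
def comparisons : CompTree → ℕ
  | leaf _ => 0
  | arith _ _ _ _ t => t.comparisons
  | branch _ t u => max t.comparisons u.comparisons + 1

end CompTree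

/-!
Squaring all roots turns the `9 ^ (1 / 2 ^ h)`-isolated unit disc into a `9`-isolated one after `h`
Graeffe transforms `p ↦ q`, `q(x ^ 2) = p(x) * p(-x)`, each of which costs `O(n log n)` flops by
fast Fourier transform. For the resulting polynomial `q`, a root `z` contributes
`r ^ N / (r ^ N - z ^ N)` to the `N`-point trapezoidal sum for the contour integral of
`q' / (2 π i q)` over the circle of radius `r = 3`. This is exponentially close to `1` if `|z| ≤ 1`
and to `0` if `|z| ≥ 9`, so `N = O(log n)` points give the number of roots up to an error below
`1 / 2`, and comparing the real part with `1 / 2, 3 / 2, …` rounds it.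
-/

section StraightLine

variable {α 𝕜 : Type*}

/-- The functions of the input that a straight-line program may use as operands once it has
computed `K`: those of `K` and the constants. -/
def withConsts (K : Set (α → 𝕜)) : Set (α → 𝕜) := K ∪ Set.range (Function.const α)

variable {K K' : Set (α → 𝕜)}

theorem subset_withConsts : K ⊆ withConsts K := Set.subset_union_left

theorem const_mem_withConsts (c : 𝕜) : Function.const α c ∈ withConsts K :=
  Or.inr ⟨c, rfl⟩

theorem withConsts_subset_withConsts (h : K' ⊆ withConsts K) : withConsts K' ⊆ withConsts K :=
  Set.union_subset h Set.subset_union_right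

theorem withConsts_mono (h : K' ⊆ K) : withConsts K' ⊆ withConsts K :=
  Set.union_subset_union_left _ h

variable [Field 𝕜]

/-- `ArithStep a b g`: the function `g` of the input results from one arithmetic operation on
`a` and `b`. A divisor must not vanish on any input, so the result is never undefined. -/
inductive ArithStep (a b : α → 𝕜) : (α → 𝕜) → Prop
  | add : ArithStep a b (a + b)
  | sub : ArithStep a b (a - b)
  | mul : ArithStep a b (a * b)
  | div (hb : ∀ x, b x ≠ 0) : ArithStep a b (a / b)

/-- Arithmetic straight-line programs over a field, on inputs from `α`: `StraightLine K c L` says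
that all functions in `L` can be computed from those in `K` and constants with at most `c`
arithmetic operations. The set `K` grows by the result of each operation. -/
inductive StraightLine : Set (α → 𝕜) → ℕ → Set (α → 𝕜) → Prop
  | nil {K L : Set (α → 𝕜)} (c : ℕ) (h : L ⊆ withConsts K) : StraightLine K c L
  | step {K L : Set (α → 𝕜)} {c : ℕ} {a b g : α → 𝕜} (ha : a ∈ withConsts K)
      (hb : b ∈ withConsts K) (hg : ArithStep a b g) (h : StraightLine (insert g K) c L) :
      StraightLine K (c + 1) L

namespace StraightLine

variable {L L' M : Set (α → 𝕜)} {a b c : ℕ} {f g r : α → 𝕜}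

theorem mono_left (h : StraightLine K' c L) (hK : K' ⊆ withConsts K) : StraightLine K c L := by
  induction h generalizing K with
  | nil c h => exact nil c (h.trans (withConsts_subset_withConsts hK))
  | step ha hb hg _ ih =>
    refine step (withConsts_subset_withConsts hK ha) (withConsts_subset_withConsts hK hb) hg
      (ih (Set.insert_subset (subset_withConsts (Set.mem_insert _ _)) ?_))
    exact hK.trans (withConsts_mono (Set.subset_insert _ _))

theorem mono_right (h : StraightLine K c L) (hL : L' ⊆ withConsts L) : StraightLine K c L' := by
  induction h with
  | nil c h => exact nil c (hL.trans (withConsts_subset_withConsts h))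
  | step ha hb hg _ ih => exact step ha hb hg (ih hL)

theorem mono_cost (h : StraightLine K a L) (hab : a ≤ b) : StraightLine K b L := by
  induction h generalizing b with
  | nil c h => exact nil b h
  | step ha hb hg _ ih =>
    obtain ⟨d, rfl⟩ := Nat.exists_eq_add_of_le' hab
    exact step ha hb hg (ih (Nat.le_add_left _ _))

theorem comp (h₁ : StraightLine K a L) (h₂ : StraightLine L b M) : StraightLine K (a + b) M := by
  induction h₁ with
  | nil c h => exact (h₂.mono_left h).mono_cost (Nat.le_add_left _ _)
  | step ha hb hg _ ih =>
    rw [Nat.add_right_comm]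
    exact step ha hb hg (ih h₂)

theorem union_of_subset (h : StraightLine K c M) (hL : L ⊆ withConsts K) :
    StraightLine K c (L ∪ M) := by
  induction h with
  | nil c h => exact nil c (Set.union_subset hL h)
  | step ha hb hg _ ih =>
    exact step ha hb hg (ih (hL.trans (withConsts_mono (Set.subset_insert _ _))))

theorem union (h₁ : StraightLine K a L) (h₂ : StraightLine K b M) :
    StraightLine K (a + b) (L ∪ M) := by
  induction h₁ with
  | nil c h => exact (h₂.union_of_subset h).mono_cost (Nat.le_add_left _ _)
  | step ha hb hg _ ih =>
    rw [Nat.add_right_comm]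
    exact step ha hb hg (ih (h₂.mono_left ((Set.subset_insert _ _).trans subset_withConsts)))

theorem image_Iio {F : ℕ → α → 𝕜} (m : ℕ) (h : ∀ i < m, StraightLine K a {F i}) :
    StraightLine K (m * a) (F '' Set.Iio m) := by
  induction m with
  | zero => exact nil _ (by simp)
  | succ m ih =>
    rw [Nat.succ_mul, ← Order.succ_eq_add_one, Order.Iio_succ_eq_insert, Set.image_insert_eq,
      Set.insert_eq, Set.union_comm]
    exact (ih fun i hi => h i (hi.trans m.lt_succ_self)).union (h m m.lt_succ_self)

theorem of_mem_withConsts (h : f ∈ withConsts K) : StraightLine K 0 {f} :=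
  nil 0 (Set.singleton_subset_iff.mpr h)

theorem of_mem (h : f ∈ K) : StraightLine K 0 {f} := of_mem_withConsts (subset_withConsts h)

theorem const (c : 𝕜) : StraightLine K 0 {Function.const α c} :=
  of_mem_withConsts (const_mem_withConsts c)

theorem arith (hf : StraightLine K a {f}) (hg : StraightLine K b {g}) (hr : ArithStep f g r) :
    StraightLine K (a + b + 1) {r} :=
  (hf.union hg).comp (step (subset_withConsts (by simp)) (subset_withConsts (by simp)) hr
    (of_mem (Set.mem_insert r _)))

theorem add (hf : StraightLine K a {f}) (hg : StraightLine K b {g}) :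
    StraightLine K (a + b + 1) {f + g} := hf.arith hg .add

theorem sub (hf : StraightLine K a {f}) (hg : StraightLine K b {g}) :
    StraightLine K (a + b + 1) {f - g} := hf.arith hg .sub

theorem mul (hf : StraightLine K a {f}) (hg : StraightLine K b {g}) :
    StraightLine K (a + b + 1) {f * g} := hf.arith hg .mul

theorem div (hf : StraightLine K a {f}) (hg : StraightLine K b {g}) (h0 : ∀ x, g x ≠ 0) :
    StraightLine K (a + b + 1) {f / g} := hf.arith hg (.div h0)

theorem sum {F : ℕ → α → 𝕜} (m : ℕ) (h : ∀ i < m, StraightLine K a {F i}) :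
    StraightLine K (m * (a + 1)) {∑ i ∈ Finset.range m, F i} := by
  induction m with
  | zero => exact (const 0).mono_cost (Nat.zero_le _)
  | succ m ih =>
    rw [Nat.succ_mul, Finset.sum_range_succ]
    exact (ih fun i hi => h i (hi.trans m.lt_succ_self)).add (h m m.lt_succ_self)

end StraightLine

end StraightLine

section ReIm

variable {α : Type*} {K L : Set (α → ℂ)} {a b g : α → ℂ}

/-- The real and imaginary parts of the functions in `K`. -/
def reIm (K : Set (α → ℂ)) : Set (α → ℝ) := (Complex.re ∘ ·) '' K ∪ (Complex.im ∘ ·) '' K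

theorem re_mem_withConsts_reIm (h : a ∈ withConsts K) : Complex.re ∘ a ∈ withConsts (reIm K) := by
  rcases h with h | ⟨c, rfl⟩
  · exact subset_withConsts (Or.inl ⟨a, h, rfl⟩)
  · exact const_mem_withConsts c.re

theorem im_mem_withConsts_reIm (h : a ∈ withConsts K) : Complex.im ∘ a ∈ withConsts (reIm K) := by
  rcases h with h | ⟨c, rfl⟩
  · exact subset_withConsts (Or.inr ⟨a, h, rfl⟩)
  · exact const_mem_withConsts c.im

theorem reIm_subset_withConsts_reIm (h : L ⊆ withConsts K) : reIm L ⊆ withConsts (reIm K) := by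
  rintro _ (⟨f, hf, rfl⟩ | ⟨f, hf, rfl⟩)
  · exact re_mem_withConsts_reIm (h hf)
  · exact im_mem_withConsts_reIm (h hf)

theorem reIm_union (K L : Set (α → ℂ)) : reIm (K ∪ L) = reIm K ∪ reIm L := by
  simp only [reIm, Set.image_union]
  ac_rfl

theorem reIm_singleton (g : α → ℂ) : reIm {g} = {Complex.re ∘ g} ∪ {Complex.im ∘ g} := by
  simp only [reIm, Set.image_singleton]

theorem straightLine_reIm_of_arithStep (ha : a ∈ withConsts K) (hb : b ∈ withConsts K)
    (hg : ArithStep a b g) : StraightLine (reIm K) 14 (reIm {g}) := by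
  have ha₁ := StraightLine.of_mem_withConsts (re_mem_withConsts_reIm ha)
  have ha₂ := StraightLine.of_mem_withConsts (im_mem_withConsts_reIm ha)
  have hb₁ := StraightLine.of_mem_withConsts (re_mem_withConsts_reIm hb)
  have hb₂ := StraightLine.of_mem_withConsts (im_mem_withConsts_reIm hb)
  suffices ∃ s t, s + t ≤ 14 ∧ StraightLine (reIm K) s {Complex.re ∘ g} ∧
      StraightLine (reIm K) t {Complex.im ∘ g} by
    obtain ⟨s, t, hst, hs, ht⟩ := this
    rw [reIm_singleton]
    exact (hs.union ht).mono_cost hst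
  cases hg with
  | add => exact ⟨1, 1, by norm_num, ha₁.add hb₁, ha₂.add hb₂⟩
  | sub => exact ⟨1, 1, by norm_num, ha₁.sub hb₁, ha₂.sub hb₂⟩
  | mul =>
    exact ⟨3, 3, by norm_num, (ha₁.mul hb₁).sub (ha₂.mul hb₂), (ha₁.mul hb₂).add (ha₂.mul hb₁)⟩
  | div h0 =>
    have hnormSq : StraightLine (reIm K) 3 {Complex.normSq ∘ b} :=
      (hb₁.mul hb₁).add (hb₂.mul hb₂)
    have hnormSq0 : ∀ x, Complex.normSq (b x) ≠ 0 := fun x => Complex.normSq_eq_zero.not.mpr (h0 x)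
    have hre : Complex.re ∘ (a / b) = ((Complex.re ∘ a) * (Complex.re ∘ b) +
        (Complex.im ∘ a) * (Complex.im ∘ b)) / (Complex.normSq ∘ b) := by
      ext x
      simp [Complex.div_re, add_div]
    have him : Complex.im ∘ (a / b) = ((Complex.im ∘ a) * (Complex.re ∘ b) -
        (Complex.re ∘ a) * (Complex.im ∘ b)) / (Complex.normSq ∘ b) := by
      ext x
      simp [Complex.div_im, sub_div]
    rw [hre, him]
    exact ⟨7, 7, by norm_num, ((ha₁.mul hb₁).add (ha₂.mul hb₂)).div hnormSq hnormSq0,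
      ((ha₂.mul hb₁).sub (ha₁.mul hb₂)).div hnormSq hnormSq0⟩

theorem straightLine_reIm {c : ℕ} (h : StraightLine K c L) :
    StraightLine (reIm K) (14 * c) (reIm L) := by
  induction h with
  | nil c h => exact .nil _ (reIm_subset_withConsts_reIm h)
  | step ha hb hg _ ih =>
    rw [Set.insert_eq, Set.union_comm, reIm_union] at ih
    rw [Nat.mul_succ, Nat.add_comm]
    exact ((straightLine_reIm_of_arithStep ha hb hg).union_of_subset subset_withConsts).comp ih

end ReIm

section TreeOfProgram

variable {α : Type*} {K L : Set (α → ℝ)} {m : α → ℕ → ℝ} {R c n : ℕ} {f : α → ℝ}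

theorem ArithStep.exists_apply {a b g : α → ℝ} (h : ArithStep a b g) :
    ∃ o : ArithOp, ∀ x, o.apply (a x) (b x) = some (g x) := by
  cases h with
  | add => exact ⟨.add, fun _ => rfl⟩
  | sub => exact ⟨.sub, fun _ => rfl⟩
  | mul => exact ⟨.mul, fun _ => rfl⟩
  | div hb => exact ⟨.div, fun x => if_neg (hb x)⟩

/-- If `m x` is the content of the registers on input `x`, then each function in `K` is held by
some register below `R`, the same for all inputs. The registers from `R` on are free. -/
def Stores (m : α → ℕ → ℝ) (R : ℕ) (K : Set (α → ℝ)) : Prop :=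
  ∀ f ∈ K, ∃ r < R, ∀ x, m x r = f x

theorem Stores.exists_operand (hm : Stores m R K) (hf : f ∈ withConsts K) :
    ∃ o : Operand, ∀ x, o.val (m x) = f x := by
  rcases hf with hf | ⟨c, rfl⟩
  · obtain ⟨r, -, hr⟩ := hm f hf
    exact ⟨.reg r, hr⟩
  · exact ⟨.const c, fun _ => rfl⟩

theorem Stores.insert_update (hm : Stores m R K) (g : α → ℝ) :
    Stores (fun x => Function.update (m x) R (g x)) (R + 1) (insert g K) := by
  rintro f (rfl | hf)
  · exact ⟨R, R.lt_succ_self, fun x => Function.update_self ..⟩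
  · obtain ⟨r, hr, h⟩ := hm f hf
    exact ⟨r, hr.trans R.lt_succ_self, fun x => (Function.update_of_ne hr.ne ..).trans (h x)⟩

theorem StraightLine.exists_prepend (h : StraightLine K c L) (hm : Stores m R K) :
    ∃ (m' : α → ℕ → ℝ) (P : CompTree → CompTree),
      (∀ T, (P T).flops ≤ T.flops + c ∧ (P T).comparisons = T.comparisons ∧
        ∀ x, (P T).run (m x) = T.run (m' x)) ∧
      ∀ f ∈ L, ∃ o : Operand, ∀ x, o.val (m' x) = f x := by
  induction h generalizing m R with
  | nil c h =>
    exact ⟨m, id, fun T => ⟨Nat.le_add_right _ _, rfl, fun _ => rfl⟩,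
      fun f hf => hm.exists_operand (h hf)⟩
  | @step K L c a b g ha hb hg _ ih =>
    obtain ⟨oa, hoa⟩ := hm.exists_operand ha
    obtain ⟨ob, hob⟩ := hm.exists_operand hb
    obtain ⟨o, ho⟩ := hg.exists_apply
    obtain ⟨m', P, hP, hL⟩ := ih (hm.insert_update g)
    refine ⟨m', fun T => .arith R o oa ob (P T), fun T => ?_, hL⟩
    obtain ⟨hflops, hcomp, hrun⟩ := hP T
    refine ⟨Nat.succ_le_succ hflops, hcomp, fun x => ?_⟩
    rw [CompTree.run, hoa, hob, ho, Option.bind_some, hrun]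

/-- The tree that compares the operands `o k`, `o (k + 1)`, … with `0` and outputs the index of the
first negative one, or `k + j` if the first `j` of them are nonnegative. -/
def linearSearch (o : ℕ → Operand) : ℕ → ℕ → CompTree
  | 0, k => .leaf k
  | j + 1, k => .branch (o k) (linearSearch o j (k + 1)) (.leaf k)

theorem flops_linearSearch (o : ℕ → Operand) (j k : ℕ) : (linearSearch o j k).flops = 0 := by
  induction j generalizing k with
  | zero => rfl
  | succ j ih => rw [linearSearch, CompTree.flops, ih, CompTree.flops, max_self]

theorem comparisons_linearSearch (o : ℕ → Operand) (j k : ℕ) :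
    (linearSearch o j k).comparisons = j := by
  induction j generalizing k with
  | zero => rfl
  | succ j ih => rw [linearSearch, CompTree.comparisons, ih, CompTree.comparisons, Nat.max_zero]

theorem run_linearSearch {o : ℕ → Operand} {m : ℕ → ℝ} {j k r : ℕ} (hk : k ≤ r) (hr : r ≤ k + j)
    (h : ∀ i < k + j, 0 ≤ (o i).val m ↔ i < r) : (linearSearch o j k).run m = some r := by
  induction j generalizing k with
  | zero => rw [linearSearch, CompTree.run, le_antisymm hk hr]
  | succ j ih =>
    rw [linearSearch, CompTree.run]
    rcases hk.lt_or_eq with hkr | rfl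
    · rw [if_pos ((h k (by lia)).mpr hkr)]
      exact ih hkr (by lia) fun i hi => h i (by lia)
    · rw [if_neg fun h0 => lt_irrefl k ((h k (by lia)).mp h0), CompTree.run]

theorem sub_add_half_nonneg_iff_lt {y : ℝ} {i r : ℕ} (h : |y - r| < 1 / 2) :
    0 ≤ y - (i + 1 / 2) ↔ i < r := by
  obtain ⟨h₁, h₂⟩ := abs_lt.mp h
  rw [← Nat.add_one_le_iff, ← Nat.cast_le (α := ℝ), Nat.cast_add_one]
  refine ⟨fun h0 => ?_, fun hir => by linarith⟩
  by_contra! hir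
  have : (r : ℝ) ≤ i := by exact_mod_cast Nat.lt_add_one_iff.mp (by exact_mod_cast hir)
  linarith

theorem StraightLine.exists_tree_of_approx (h : StraightLine K c {f}) (hm : Stores m R K)
    {r : α → ℕ} (hr : ∀ x, r x ≤ n) (hf : ∀ x, |f x - r x| < 1 / 2) :
    ∃ T : CompTree, T.flops ≤ c + n ∧ T.comparisons = n ∧ ∀ x, T.run (m x) = some (r x) := by
  let threshold (i : ℕ) : α → ℝ := f - Function.const α (i + 1 / 2 : ℝ)
  have hthreshold : StraightLine K (c + n * 1) (threshold '' Set.Iio n) :=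
    h.comp <| .image_Iio n fun i _ => (of_mem (Set.mem_singleton f)).sub (.const _)
  obtain ⟨m', P, hP, hoperand⟩ := hthreshold.exists_prepend hm
  have : ∀ i, ∃ o : Operand, i < n → ∀ x, o.val (m' x) = f x - (i + 1 / 2) := fun i => by
    by_cases hi : i < n
    · exact (hoperand _ ⟨i, hi, rfl⟩).imp fun o ho _ => ho
    · exact ⟨.const 0, fun h => absurd h hi⟩
  choose o ho using this
  obtain ⟨hflops, hcomp, hrun⟩ := hP (linearSearch o n 0)
  rw [flops_linearSearch, zero_add, mul_one] at hflops
  rw [comparisons_linearSearch] at hcomp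
  refine ⟨_, hflops, hcomp, fun x => ?_⟩
  rw [hrun]
  refine run_linearSearch (Nat.zero_le _) ((hr x).trans_eq (zero_add n).symm) fun i hi => ?_
  rw [ho i (hi.trans_eq (zero_add n))]
  exact sub_add_half_nonneg_iff_lt (hf x)

end TreeOfProgram

section Graeffe

variable {R : Type*} [CommRing R] (p : R[X])

/-- The polynomial `e` in the decomposition `p = e(X ^ 2) + X * o(X ^ 2)`. -/
noncomputable def evenPart : R[X] := contract 2 p

/-- The polynomial `o` in the decomposition `p = e(X ^ 2) + X * o(X ^ 2)`. -/
noncomputable def oddPart : R[X] := contract 2 p.divX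

theorem coeff_evenPart (n : ℕ) : (evenPart p).coeff n = p.coeff (n * 2) :=
  coeff_contract two_ne_zero p n

theorem coeff_oddPart (n : ℕ) : (oddPart p).coeff n = p.coeff (n * 2 + 1) := by
  rw [oddPart, coeff_contract two_ne_zero, coeff_divX]

theorem natDegree_evenPart_le : (evenPart p).natDegree ≤ p.natDegree / 2 :=
  natDegree_le_iff_coeff_eq_zero.mpr fun n hn => by
    rw [coeff_evenPart]
    exact coeff_eq_zero_of_natDegree_lt (by lia)

theorem natDegree_oddPart_le : (oddPart p).natDegree ≤ p.natDegree / 2 :=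
  natDegree_le_iff_coeff_eq_zero.mpr fun n hn => by
    rw [coeff_oddPart]
    exact coeff_eq_zero_of_natDegree_lt (by lia)

theorem expand_evenPart_add_X_mul_expand_oddPart :
    expand R 2 (evenPart p) + X * expand R 2 (oddPart p) = p := by
  ext n
  rw [coeff_add]
  rcases n.even_or_odd' with ⟨k, rfl | rfl⟩
  · have hodd : (X * expand R 2 (oddPart p)).coeff (2 * k) = 0 := by
      cases k with
      | zero => rw [mul_zero, coeff_X_mul_zero]
      | succ k => rw [Nat.mul_succ, coeff_X_mul, coeff_expand two_pos, if_neg (by lia)]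
    rw [hodd, coeff_expand_mul' two_pos, coeff_evenPart, mul_comm, add_zero]
  · rw [coeff_X_mul, coeff_expand_mul' two_pos, coeff_oddPart, coeff_expand two_pos,
      if_neg (by lia), mul_comm, zero_add]

theorem eval_eq_evenPart_add_oddPart (x : R) :
    p.eval x = (evenPart p).eval (x ^ 2) + x * (oddPart p).eval (x ^ 2) := by
  conv_lhs => rw [← expand_evenPart_add_X_mul_expand_oddPart p]
  rw [eval_add, eval_mul, eval_X, expand_eval, expand_eval]

theorem expand_evenPart_sq_sub :
    expand R 2 (evenPart p ^ 2 - X * oddPart p ^ 2) = p * p.comp (-X) := by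
  have hcomp : p.comp (-X) = expand R 2 (evenPart p) - X * expand R 2 (oddPart p) := by
    conv_lhs => rw [← expand_evenPart_add_X_mul_expand_oddPart p]
    simp only [add_comp, mul_comp, X_comp, expand_eq_comp_X_pow, comp_assoc, X_pow_comp, neg_sq]
    ring
  conv_rhs => rw [hcomp]; enter [1]; rw [← expand_evenPart_add_X_mul_expand_oddPart p]
  simp only [map_sub, map_mul, map_pow, expand_X]
  ring

/-- The Dandelin–Graeffe root-squaring transform, characterized by `expand_graeffe`. -/
noncomputable def graeffe : R[X] →* R[X] where
  toFun p := evenPart p ^ 2 - X * oddPart p ^ 2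
  map_one' := expand_injective two_pos (by rw [expand_evenPart_sq_sub]; simp)
  map_mul' p q := expand_injective two_pos (by
    simp only [map_mul, expand_evenPart_sq_sub, mul_comp_neg_X]
    ring)

theorem expand_graeffe : expand R 2 (graeffe p) = p * p.comp (-X) := expand_evenPart_sq_sub p

theorem eval_graeffe_sq (x : R) : (graeffe p).eval (x ^ 2) = p.eval x * p.eval (-x) := by
  rw [← expand_eval, expand_graeffe, eval_mul, eval_comp, eval_neg, eval_X]

theorem graeffe_C (a : R) : graeffe (C a) = C (a ^ 2) :=
  expand_injective two_pos (by rw [expand_graeffe, C_comp, expand_C, C_pow, sq])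

theorem graeffe_X_sub_C (a : R) : graeffe (X - C a) = -(X - C (a ^ 2)) :=
  expand_injective two_pos (by
    simp only [expand_graeffe, sub_comp, X_comp, C_comp, map_neg, map_sub, map_pow, expand_X,
      expand_C]
    ring)

theorem natDegree_graeffe_le : (graeffe p).natDegree ≤ p.natDegree := by
  have h : (p * p.comp (-X)).natDegree ≤ p.natDegree + p.natDegree * 1 :=
    natDegree_mul_le.trans <| Nat.add_le_add_left (natDegree_comp_le.trans <|
      Nat.mul_le_mul_left _ ((natDegree_neg _).trans_le natDegree_X_le)) _
  rw [← expand_graeffe, natDegree_expand] at h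
  lia

theorem natDegree_iterate_graeffe_le (h : ℕ) : (graeffe^[h] p).natDegree ≤ p.natDegree := by
  induction h with
  | zero => rfl
  | succ h ih =>
    rw [Function.iterate_succ_apply']
    exact (natDegree_graeffe_le _).trans ih

theorem graeffe_ne_zero [NoZeroDivisors R] {p : R[X]} (hp : p ≠ 0) : graeffe p ≠ 0 := by
  rw [← expand_ne_zero two_pos, expand_graeffe]
  exact mul_ne_zero hp (comp_neg_X_eq_zero_iff.not.mpr hp)

theorem iterate_graeffe_ne_zero [NoZeroDivisors R] {p : R[X]} (hp : p ≠ 0) (h : ℕ) :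
    graeffe^[h] p ≠ 0 := by
  induction h with
  | zero => exact hp
  | succ h ih =>
    rw [Function.iterate_succ_apply']
    exact graeffe_ne_zero ih

theorem roots_graeffe [IsDomain R] {p : R[X]} (hp : p.Splits) :
    (graeffe p).roots = p.roots.map (· ^ 2) := by
  rcases eq_or_ne p 0 with rfl | hp0
  · rw [← C_0, graeffe_C, zero_pow two_ne_zero, C_0, roots_zero, Multiset.map_zero]
  have hfactors : graeffe p =
      C (p.leadingCoeff ^ 2) * (p.roots.map fun a => -(X - C (a ^ 2))).prod := by
    conv_lhs => rw [hp.eq_prod_roots]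
    rw [map_mul, graeffe_C, map_multiset_prod, Multiset.map_map]
    simp only [Function.comp_def, graeffe_X_sub_C]
  rw [hfactors, roots_C_mul _ (pow_ne_zero 2 (leadingCoeff_ne_zero.mpr hp0)),
    roots_multiset_prod, Multiset.bind_map]
  · simp only [roots_neg, roots_X_sub_C, Multiset.bind_singleton]
  · simp only [Multiset.mem_map, neg_eq_zero, X_sub_C_ne_zero, and_false, exists_false,
      not_false_eq_true]

theorem roots_iterate_graeffe {𝕜 : Type*} [Field 𝕜] [IsAlgClosed 𝕜] (p : 𝕜[X]) (h : ℕ) :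
    (graeffe^[h] p).roots = p.roots.map (· ^ 2 ^ h) := by
  induction h with
  | zero => simp only [pow_zero, pow_one, Multiset.map_id', Function.iterate_zero_apply]
  | succ h ih =>
    rw [Function.iterate_succ_apply', roots_graeffe (IsAlgClosed.splits _), ih, Multiset.map_map]
    simp only [Function.comp_def, ← pow_mul, ← pow_succ]

end Graeffe

section Fourier

variable {α 𝕜 : Type*} [Field 𝕜] {K : Set (α → 𝕜)} {w : 𝕜} {p : α → 𝕜[X]} {a k m : ℕ}

/-- The coefficients of a family of polynomials `p x`, as functions of the input `x`. -/
def coeffFunctions (p : α → 𝕜[X]) : Set (α → 𝕜) := Set.range fun i x => (p x).coeff i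

/-- The values at the powers of `w` of a family of polynomials `p x`, as functions of the
input `x`. -/
def powerValues (w : 𝕜) (p : α → 𝕜[X]) : Set (α → 𝕜) :=
  Set.range fun (j : ℕ) x => (p x).eval (w ^ j)

theorem coeff_mem_coeffFunctions (p : α → 𝕜[X]) (i : ℕ) :
    (fun x => (p x).coeff i) ∈ coeffFunctions p := ⟨i, rfl⟩

theorem eval_mem_powerValues (w : 𝕜) (p : α → 𝕜[X]) (j : ℕ) :
    (fun x => (p x).eval (w ^ j)) ∈ powerValues w p := ⟨j, rfl⟩

theorem coeffFunctions_evenPart_subset (p : α → 𝕜[X]) :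
    coeffFunctions (fun x => evenPart (p x)) ⊆ coeffFunctions p :=
  Set.range_subset_iff.mpr fun i => ⟨i * 2, funext fun x => (coeff_evenPart (p x) i).symm⟩

theorem coeffFunctions_oddPart_subset (p : α → 𝕜[X]) :
    coeffFunctions (fun x => oddPart (p x)) ⊆ coeffFunctions p :=
  Set.range_subset_iff.mpr fun i => ⟨i * 2 + 1, funext fun x => (coeff_oddPart (p x) i).symm⟩

theorem straightLine_coeffFunctions (hp : ∀ x, (p x).natDegree < m)
    (h : ∀ i < m, StraightLine K a {fun x => (p x).coeff i}) :
    StraightLine K (m * a) (coeffFunctions p) := by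
  refine (StraightLine.image_Iio m h).mono_right ?_
  rintro _ ⟨i, rfl⟩
  rcases lt_or_ge i m with hi | hi
  · exact subset_withConsts ⟨i, hi, rfl⟩
  · exact Or.inr ⟨0, funext fun x => (coeff_eq_zero_of_natDegree_lt ((hp x).trans_le hi)).symm⟩

theorem straightLine_powerValues (hm : 0 < m) (hw : w ^ m = 1)
    (h : ∀ j < m, StraightLine K a {fun x => (p x).eval (w ^ j)}) :
    StraightLine K (m * a) (powerValues w p) := by
  refine (StraightLine.image_Iio m h).mono_right (Set.Subset.trans ?_ subset_withConsts)
  rintro _ ⟨j, rfl⟩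
  exact ⟨j % m, Nat.mod_lt j hm, funext fun x => by dsimp only; rw [← pow_eq_pow_mod j hw]⟩

theorem straightLine_powerValues_of_evenPart_oddPart (hm : 0 < m) (hw : w ^ m = 1) :
    StraightLine (powerValues (w ^ 2) (fun x => evenPart (p x)) ∪
      powerValues (w ^ 2) fun x => oddPart (p x)) (m * 2) (powerValues w p) := by
  refine straightLine_powerValues hm hw fun j _ => ?_
  have heq : (fun x => (p x).eval (w ^ j)) = (fun x => (evenPart (p x)).eval ((w ^ 2) ^ j)) +
      Function.const α (w ^ j) * fun x => (oddPart (p x)).eval ((w ^ 2) ^ j) := by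
    ext x
    rw [eval_eq_evenPart_add_oddPart, pow_right_comm]
    rfl
  rw [heq]
  exact (StraightLine.of_mem (Or.inl (eval_mem_powerValues _ _ j))).add
    ((StraightLine.const _).mul (.of_mem (Or.inr (eval_mem_powerValues _ _ j))))

theorem straightLine_powerValues_of_coeffFunctions (hw : w ^ 2 ^ k = 1)
    (hp : ∀ x, (p x).natDegree < 2 ^ k) :
    StraightLine (coeffFunctions p) (2 * k * 2 ^ k) (powerValues w p) := by
  induction k generalizing w p with
  | zero =>
    refine .nil _ (Set.Subset.trans ?_ subset_withConsts)
    rintro _ ⟨j, rfl⟩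
    refine ⟨0, funext fun x => ?_⟩
    dsimp only
    rw [eq_C_of_natDegree_eq_zero (Nat.lt_one_iff.mp (hp x)), eval_C, coeff_C_zero]
  | succ k ih =>
    have hw2 : (w ^ 2) ^ 2 ^ k = 1 := by rw [← pow_mul, ← pow_succ', hw]
    have hp2 (x : α) : (p x).natDegree / 2 < 2 ^ k := Nat.div_lt_of_lt_mul (pow_succ' 2 k ▸ hp x)
    have heven : StraightLine (coeffFunctions p) _ _ :=
      (ih hw2 fun x => (natDegree_evenPart_le _).trans_lt (hp2 x)).mono_left
        ((coeffFunctions_evenPart_subset p).trans subset_withConsts)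
    have hodd : StraightLine (coeffFunctions p) _ _ :=
      (ih hw2 fun x => (natDegree_oddPart_le _).trans_lt (hp2 x)).mono_left
        ((coeffFunctions_oddPart_subset p).trans subset_withConsts)
    exact ((heven.union hodd).comp (straightLine_powerValues_of_evenPart_oddPart (by positivity)
      hw)).mono_cost (by ring_nf; rfl)

/-- The polynomial of degree below `m` whose coefficients are the values of `p` at the first `m`
powers of `w`. Its values at the powers of `w⁻¹` are, up to the factor `m`, the coefficients
of `p`. -/
noncomputable def dualPolynomial (m : ℕ) (w : 𝕜) (p : 𝕜[X]) : 𝕜[X] :=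
  ∑ j ∈ Finset.range m, monomial j (p.eval (w ^ j))

theorem coeff_dualPolynomial (p : 𝕜[X]) (i : ℕ) :
    (dualPolynomial m w p).coeff i = if i < m then p.eval (w ^ i) else 0 := by
  simp only [dualPolynomial, finsetSum_coeff, coeff_monomial, Finset.sum_ite_eq',
    Finset.mem_range]

theorem natDegree_dualPolynomial_lt (hm : 0 < m) (p : 𝕜[X]) :
    (dualPolynomial m w p).natDegree < m :=
  Nat.lt_of_le_sub_one hm <| natDegree_le_iff_coeff_eq_zero.mpr fun i hi => by
    rw [coeff_dualPolynomial, if_neg (by lia)]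

theorem sum_pow_mul_inv_pow (hw : IsPrimitiveRoot w m) {i j : ℕ} (hi : i < m) (hj : j < m) :
    ∑ l ∈ Finset.range m, (w ^ i * w⁻¹ ^ j) ^ l = if i = j then (m : 𝕜) else 0 := by
  have hw0 : w ≠ 0 := hw.ne_zero (by lia)
  split_ifs with hij
  · simp only [hij, ← mul_pow, mul_inv_cancel₀ hw0, one_pow, Finset.sum_const, Finset.card_range,
      nsmul_one]
  · have hne : w ^ i * w⁻¹ ^ j ≠ 1 := by
      rw [inv_pow, Ne, mul_inv_eq_one₀ (pow_ne_zero _ hw0)]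
      exact fun h => hij (hw.pow_inj hi hj h)
    have hpow : (w ^ i * w⁻¹ ^ j) ^ m = 1 := by
      rw [mul_pow, pow_right_comm, pow_right_comm w⁻¹, inv_pow, hw.pow_eq_one]
      simp only [one_pow, inv_one, mul_one]
    rw [geom_sum_eq hne, hpow, sub_self, zero_div]

theorem eval_dualPolynomial_inv_pow (hw : IsPrimitiveRoot w m) {p : 𝕜[X]} (hp : p.natDegree < m)
    {j : ℕ} (hj : j < m) : (dualPolynomial m w p).eval (w⁻¹ ^ j) = m * p.coeff j :=
  calc (dualPolynomial m w p).eval (w⁻¹ ^ j)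
    _ = ∑ l ∈ Finset.range m, (∑ i ∈ Finset.range m, p.coeff i * (w ^ l) ^ i) * (w⁻¹ ^ j) ^ l := by
      simp only [dualPolynomial, eval_finsetSum, eval_monomial, eval_eq_sum_range' hp]
    _ = ∑ i ∈ Finset.range m, p.coeff i * ∑ l ∈ Finset.range m, (w ^ i * w⁻¹ ^ j) ^ l := by
      simp only [Finset.sum_mul, Finset.mul_sum]
      rw [Finset.sum_comm]
      refine Finset.sum_congr rfl fun i _ => Finset.sum_congr rfl fun l _ => ?_
      rw [mul_pow, pow_right_comm, mul_assoc]
    _ = ∑ i ∈ Finset.range m, p.coeff i * if i = j then (m : 𝕜) else 0 :=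
      Finset.sum_congr rfl fun i hi => by
        rw [sum_pow_mul_inv_pow hw (Finset.mem_range.mp hi) hj]
    _ = m * p.coeff j := by
      rw [Finset.sum_eq_single_of_mem j (Finset.mem_range.mpr hj)
        fun i _ hij => by rw [if_neg hij, mul_zero], if_pos rfl, mul_comm]

theorem straightLine_coeffFunctions_of_powerValues (hw : IsPrimitiveRoot w (2 ^ k))
    (hp : ∀ x, (p x).natDegree < 2 ^ k) :
    StraightLine (powerValues w p) ((2 * k + 1) * 2 ^ k) (coeffFunctions p) := by
  let q x := dualPolynomial (2 ^ k) w (p x)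
  have hq : coeffFunctions q ⊆ withConsts (powerValues w p) := by
    rintro _ ⟨i, rfl⟩
    by_cases hi : i < 2 ^ k
    · exact subset_withConsts ⟨i, funext fun x => by simp only [q, coeff_dualPolynomial, if_pos hi]⟩
    · exact Or.inr ⟨0, funext fun x => by simp only [q, coeff_dualPolynomial, if_neg hi]; rfl⟩
  have hfourier : StraightLine (powerValues w p) (2 * k * 2 ^ k) (powerValues w⁻¹ q) :=
    (straightLine_powerValues_of_coeffFunctions (by rw [inv_pow, hw.pow_eq_one, inv_one])
      fun x => natDegree_dualPolynomial_lt (by positivity) _).mono_left hq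
  have : NeZero ((2 ^ k : ℕ) : 𝕜) := hw.neZero'
  have hnormalize : StraightLine (powerValues w⁻¹ q) (2 ^ k * 1) (coeffFunctions p) := by
    refine straightLine_coeffFunctions hp fun i hi => ?_
    have heq : (fun x => (p x).coeff i) =
        (fun x => (q x).eval (w⁻¹ ^ i)) / Function.const α ((2 ^ k : ℕ) : 𝕜) := by
      ext x
      exact (mul_div_cancel_left₀ _ (NeZero.ne ((2 ^ k : ℕ) : 𝕜))).symm.trans
        (congrArg (· / _) (eval_dualPolynomial_inv_pow hw (hp x) hi).symm)
    rw [heq]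
    exact (StraightLine.of_mem (eval_mem_powerValues w⁻¹ q i)).div (.const _)
      fun _ => NeZero.ne ((2 ^ k : ℕ) : 𝕜)
  exact (hfourier.comp hnormalize).mono_cost (by ring_nf; rfl)

theorem straightLine_coeffFunctions_graeffe (hw : IsPrimitiveRoot w (2 ^ (k + 1)))
    (hp : ∀ x, (p x).natDegree < 2 ^ k) :
    StraightLine (coeffFunctions p) (6 * (k + 1) * 2 ^ k)
      (coeffFunctions fun x => graeffe (p x)) := by
  have hvalues : StraightLine (coeffFunctions p) _ (powerValues w p) :=
    straightLine_powerValues_of_coeffFunctions hw.pow_eq_one fun x =>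
      (hp x).trans (Nat.pow_lt_pow_succ one_lt_two)
  have hw2 : IsPrimitiveRoot (w ^ 2) (2 ^ k) := hw.pow (by positivity) (pow_succ' 2 k)
  have hneg : w ^ 2 ^ k = -1 :=
    (hw.pow (by positivity) (pow_succ 2 k)).eq_neg_one_of_two_right
  have hgraeffe : StraightLine (powerValues w p) (2 ^ k * 1)
      (powerValues (w ^ 2) fun x => graeffe (p x)) := by
    refine straightLine_powerValues (by positivity) hw2.pow_eq_one fun j _ => ?_
    have heq : (fun x => (graeffe (p x)).eval ((w ^ 2) ^ j)) =
        (fun x => (p x).eval (w ^ j)) * fun x => (p x).eval (w ^ (j + 2 ^ k)) := by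
      ext x
      rw [pow_right_comm, eval_graeffe_sq, Pi.mul_apply, pow_add, hneg, mul_neg_one]
    rw [heq]
    exact (StraightLine.of_mem (eval_mem_powerValues w p j)).mul
      (.of_mem (eval_mem_powerValues w p (j + 2 ^ k)))
  exact ((hvalues.comp hgraeffe).comp (straightLine_coeffFunctions_of_powerValues hw2 fun x =>
    (natDegree_graeffe_le _).trans_lt (hp x))).mono_cost (by ring_nf; rfl)

theorem straightLine_coeffFunctions_iterate_graeffe (hw : IsPrimitiveRoot w (2 ^ (k + 1)))
    (hp : ∀ x, (p x).natDegree < 2 ^ k) (h : ℕ) :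
    StraightLine (coeffFunctions p) (h * (6 * (k + 1) * 2 ^ k))
      (coeffFunctions fun x => graeffe^[h] (p x)) := by
  induction h with
  | zero => exact .nil _ subset_withConsts
  | succ h ih =>
    simp only [Function.iterate_succ_apply']
    rw [Nat.succ_mul]
    exact ih.comp (straightLine_coeffFunctions_graeffe hw fun x =>
      (natDegree_iterate_graeffe_le _ h).trans_lt (hp x))

end Fourier

section CauchySum

variable {α 𝕜 : Type*} [Field 𝕜] {p q : α → 𝕜[X]} {m N : ℕ} {v r : 𝕜}

theorem straightLine_eval (hp : ∀ x, (p x).natDegree < m) (c : 𝕜) :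
    StraightLine (coeffFunctions p) (m * 2) {fun x => (p x).eval c} := by
  have heq : (fun x => (p x).eval c) =
      ∑ i ∈ Finset.range m, (fun x => (p x).coeff i) * Function.const α (c ^ i) := by
    ext x
    simp only [eval_eq_sum_range' (hp x), Finset.sum_apply, Pi.mul_apply, Function.const_apply]
  rw [heq]
  exact .sum m fun i _ => (StraightLine.of_mem (coeff_mem_coeffFunctions p i)).mul (.const _)

theorem straightLine_coeffFunctions_derivative (hp : ∀ x, (p x).natDegree < m) :
    StraightLine (coeffFunctions p) m (coeffFunctions fun x => derivative (p x)) := by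
  rw [← mul_one m]
  refine straightLine_coeffFunctions
    (fun x => (natDegree_derivative_le _).trans_lt ((Nat.sub_le _ _).trans_lt (hp x))) fun i _ => ?_
  have heq : (fun x => (derivative (p x)).coeff i) =
      (fun x => (p x).coeff (i + 1)) * Function.const α (i + 1 : 𝕜) :=
    funext fun x => coeff_derivative _ _
  rw [heq]
  exact (StraightLine.of_mem (coeff_mem_coeffFunctions p (i + 1))).mul (.const _)

/-- The `N`-point trapezoidal approximation of the contour integral of `q' / (2 π i q)` over the
circle of radius `r` around `0`, where `v` is a primitive `N`-th root of unity. -/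
noncomputable def cauchySum (N : ℕ) (v r : 𝕜) (q : 𝕜[X]) : 𝕜 :=
  (∑ j ∈ Finset.range N,
    v ^ j * r * (derivative q).eval (v ^ j * r) / q.eval (v ^ j * r)) / N

theorem straightLine_cauchySum (hq : ∀ x, (q x).natDegree < m) (hN : (N : 𝕜) ≠ 0)
    (hq0 : ∀ x, ∀ j < N, (q x).eval (v ^ j * r) ≠ 0) :
    StraightLine (coeffFunctions q) (m + N * (4 * m + 3) + 1)
      {fun x => cauchySum N v r (q x)} := by
  have heq : (fun x => cauchySum N v r (q x)) =
      (∑ j ∈ Finset.range N, Function.const α (v ^ j * r) *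
        (fun x => (derivative (q x)).eval (v ^ j * r)) / fun x => (q x).eval (v ^ j * r)) /
      Function.const α (N : 𝕜) := by
    ext x
    simp only [cauchySum, Pi.div_apply, Pi.mul_apply, Finset.sum_apply, Function.const_apply]
  have hterm (j : ℕ) (hj : j < N) :
      StraightLine (coeffFunctions q ∪ coeffFunctions fun x => derivative (q x)) (4 * m + 2)
        {(Function.const α (v ^ j * r) * fun x => (derivative (q x)).eval (v ^ j * r)) /
          fun x => (q x).eval (v ^ j * r)} := by
    have hq' (x : α) : (derivative (q x)).natDegree < m :=
      (natDegree_derivative_le _).trans_lt ((Nat.sub_le _ _).trans_lt (hq x))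
    have hnum := (straightLine_eval hq' (v ^ j * r)).mono_left
      ((Set.subset_union_right (s := coeffFunctions q)).trans subset_withConsts)
    have hden := (straightLine_eval hq (v ^ j * r)).mono_left
      ((Set.subset_union_left (t := coeffFunctions fun x => derivative (q x))).trans
        subset_withConsts)
    exact (((StraightLine.const _).mul hnum).div hden fun x => hq0 x j hj).mono_cost (by lia)
  rw [heq]
  exact ((straightLine_coeffFunctions_derivative hq).union_of_subset subset_withConsts).comp
    ((StraightLine.sum N hterm).div (.const _) fun _ => hN)

end CauchySum

section CauchySumRoots

variable {𝕜 : Type*} [Field 𝕜] {N : ℕ} {v r z : 𝕜} {q : 𝕜[X]}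

theorem sum_div_sub_eq (hv : IsPrimitiveRoot v N) (hz : z ^ N ≠ r ^ N) :
    ∑ j ∈ Finset.range N, v ^ j * r / (v ^ j * r - z) = N * r ^ N / (r ^ N - z ^ N) := by
  have hN : N ≠ 0 := by
    rintro rfl
    exact hz (by rw [pow_zero, pow_zero])
  have hz0 : z ^ N - r ^ N ≠ 0 := sub_ne_zero.mpr hz
  have hne (j : ℕ) : v ^ j * r - z ≠ 0 := fun h => hz <| by
    rw [← sub_eq_zero.mp h, mul_pow, pow_right_comm, hv.pow_eq_one, one_pow, one_mul]
  have hlogDeriv : ∑ j ∈ Finset.range N, 1 / (z - v ^ j * r) =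
      N * z ^ (N - 1) / (z ^ N - r ^ N) := by
    have h := (X_pow_sub_C_splits_of_isPrimitiveRoot hv rfl).eval_derivative_div_eval_of_ne_zero
      (x := z) (by simpa using hz0)
    rw [← nthRoots, hv.nthRoots_eq rfl, Multiset.map_map] at h
    simp only [derivative_sub, derivative_X_pow, derivative_C, sub_zero, eval_mul, eval_sub,
      eval_pow, eval_X, eval_C, map_natCast, eval_natCast] at h
    exact h.symm
  calc ∑ j ∈ Finset.range N, v ^ j * r / (v ^ j * r - z)
    _ = ∑ j ∈ Finset.range N, (1 - z * (1 / (z - v ^ j * r))) :=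
      Finset.sum_congr rfl fun j _ => by
        rw [← neg_sub (v ^ j * r) z]
        field_simp [hne j]
        ring
    _ = N - z * (N * z ^ (N - 1) / (z ^ N - r ^ N)) := by
      rw [Finset.sum_sub_distrib, ← Finset.mul_sum, hlogDeriv, Finset.sum_const, Finset.card_range,
        nsmul_one]
    _ = N - N * z ^ N / (z ^ N - r ^ N) := by
      rw [← mul_div_assoc, mul_left_comm, mul_pow_sub_one hN]
    _ = N * r ^ N / (r ^ N - z ^ N) := by
      rw [← neg_sub (z ^ N)]
      field_simp
      ring

theorem eval_pow_mul_ne_zero (hv : v ^ N = 1) (hq : q ≠ 0) (hroots : ∀ z ∈ q.roots, z ^ N ≠ r ^ N)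
    (j : ℕ) : q.eval (v ^ j * r) ≠ 0 := fun h =>
  hroots _ ((mem_roots hq).mpr h) <| by rw [mul_pow, pow_right_comm, hv, one_pow, one_mul]

theorem cauchySum_eq [NeZero N] (hv : IsPrimitiveRoot v N) (hsplits : q.Splits) (hq : q ≠ 0)
    (hroots : ∀ z ∈ q.roots, z ^ N ≠ r ^ N) :
    cauchySum N v r q = (q.roots.map fun z => r ^ N / (r ^ N - z ^ N)).sum := by
  have : NeZero (N : 𝕜) := hv.neZero'
  have hterm (j : ℕ) : v ^ j * r * (derivative q).eval (v ^ j * r) / q.eval (v ^ j * r) =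
      (q.roots.map fun z => v ^ j * r / (v ^ j * r - z)).sum := by
    rw [mul_div_assoc, hsplits.eval_derivative_div_eval_of_ne_zero
      (eval_pow_mul_ne_zero hv.pow_eq_one hq hroots j), ← Multiset.sum_map_mul_left]
    simp only [mul_one_div]
  rw [cauchySum, div_eq_iff (NeZero.ne _), Finset.sum_congr rfl fun j _ => hterm j,
    ← Multiset.sum_map_mul_right]
  refine (Multiset.sum_map_sum_map _ _).trans <|
    congrArg Multiset.sum (Multiset.map_congr rfl fun z hz => ?_)
  rw [mul_comm, ← mul_div_assoc]
  exact sum_div_sub_eq hv (hroots z hz)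

end CauchySumRoots

section Approximation

theorem norm_div_sub_sub_one_le {a : ℝ} (ha : 1 < a) {t : ℂ} (ht : ‖t‖ ≤ 1) :
    ‖a / (a - t) - 1‖ ≤ 1 / (a - 1) := by
  have hdist : a - 1 ≤ ‖(a : ℂ) - t‖ := by
    have := norm_sub_norm_le (a : ℂ) t
    rw [Complex.norm_of_nonneg (by linarith)] at this
    linarith
  have hne : (a : ℂ) - t ≠ 0 := norm_pos_iff.mp ((sub_pos.mpr ha).trans_le hdist)
  rw [div_sub_one hne, sub_sub_cancel, norm_div]
  exact div_le_div₀ zero_le_one ht (sub_pos.mpr ha) hdist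

theorem norm_div_sub_le {a : ℝ} (ha : 1 < a) {t : ℂ} (ht : a ^ 2 ≤ ‖t‖) :
    ‖a / (a - t)‖ ≤ 1 / (a - 1) := by
  have ha0 : 0 < a := zero_lt_one.trans ha
  have hdist : a * (a - 1) ≤ ‖(a : ℂ) - t‖ := by
    have := norm_sub_norm_le t (a : ℂ)
    rw [Complex.norm_of_nonneg ha0.le, norm_sub_rev] at this
    linarith
  rw [norm_div, Complex.norm_of_nonneg ha0.le]
  calc a / ‖(a : ℂ) - t‖ ≤ a / (a * (a - 1)) :=
        div_le_div_of_nonneg_left ha0.le (mul_pos ha0 (sub_pos.mpr ha)) hdist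
    _ = 1 / (a - 1) := by rw [← div_div, div_self ha0.ne']

theorem norm_sum_map_sub_countP_le {β E : Type*} [SeminormedRing E] {f : β → E} {P : β → Prop}
    [DecidablePred P] {ε : ℝ} {s : Multiset β} (h : ∀ z ∈ s, ‖f z - if P z then 1 else 0‖ ≤ ε) :
    ‖(s.map f).sum - s.countP P‖ ≤ s.card * ε := by
  induction s using Multiset.induction with
  | empty => simp
  | cons z s ih =>
    have hz := h z (Multiset.mem_cons_self z s)
    have hs := ih fun y hy => h y (Multiset.mem_cons_of_mem hy)
    rw [Multiset.map_cons, Multiset.sum_cons, Multiset.countP_cons, Multiset.card_cons]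
    push_cast
    rw [add_comm (s.countP P : E), add_sub_add_comm]
    exact (norm_add_le_of_le hz hs).trans_eq (by ring)

theorem ne_ofReal_of_norm {a : ℝ} (ha : 1 < a) {t : ℂ} (ht : ‖t‖ ≤ 1 ∨ a ^ 2 ≤ ‖t‖) :
    t ≠ a := by
  rintro rfl
  rw [Complex.norm_of_nonneg (by linarith)] at ht
  rcases ht with ht | ht <;> nlinarith

theorem norm_div_sub_sub_ite_le {a : ℝ} (ha : 1 < a) {t : ℂ} (ht : ‖t‖ ≤ 1 ∨ a ^ 2 ≤ ‖t‖) :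
    ‖a / (a - t) - if ‖t‖ ≤ 1 then 1 else 0‖ ≤ 1 / (a - 1) := by
  split_ifs with h
  · exact norm_div_sub_sub_one_le ha h
  · rw [sub_zero]
    exact norm_div_sub_le ha (ht.resolve_left h)

theorem norm_pow_le_one_or_sq_le {ρ : ℝ} {z : ℂ} (hz : ‖z‖ ≤ 1 ∨ ρ ^ 2 ≤ ‖z‖) (N : ℕ) :
    ‖z ^ N‖ ≤ 1 ∨ (ρ ^ N) ^ 2 ≤ ‖z ^ N‖ := by
  rw [norm_pow, pow_right_comm]
  exact hz.imp (pow_le_one₀ (norm_nonneg z)) fun h => by gcongr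

theorem pow_ne_ofReal_pow {ρ : ℝ} {N : ℕ} (hN : 1 < ρ ^ N) {z : ℂ}
    (hz : ‖z‖ ≤ 1 ∨ ρ ^ 2 ≤ ‖z‖) : z ^ N ≠ (ρ : ℂ) ^ N := by
  rw [← Complex.ofReal_pow]
  exact ne_ofReal_of_norm hN (norm_pow_le_one_or_sq_le hz N)

theorem norm_cauchySum_sub_countP_lt {N : ℕ} [NeZero N] {v : ℂ} {ρ : ℝ} {q : ℂ[X]}
    (hv : IsPrimitiveRoot v N) (hN : 2 * q.natDegree + 1 < ρ ^ N) (hq : q ≠ 0)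
    (hroots : ∀ z ∈ q.roots, ‖z‖ ≤ 1 ∨ ρ ^ 2 ≤ ‖z‖) :
    ‖cauchySum N v ρ q - q.roots.countP (‖·‖ ≤ 1)‖ < 1 / 2 := by
  have hcard : (q.roots.card : ℝ) ≤ q.natDegree := by exact_mod_cast q.card_roots'
  have hN1 : 1 < ρ ^ N := by linarith [q.natDegree.cast_nonneg (α := ℝ)]
  rw [cauchySum_eq hv (IsAlgClosed.splits q) hq fun z hz => pow_ne_ofReal_pow hN1 (hroots z hz)]
  calc _ ≤ q.roots.card * (1 / (ρ ^ N - 1)) := norm_sum_map_sub_countP_le fun z hz => by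
        have hiff : ‖z‖ ≤ 1 ↔ ‖z ^ N‖ ≤ 1 := by
          rw [norm_pow, pow_le_one_iff_of_nonneg (norm_nonneg z) (NeZero.ne N)]
        rw [if_congr hiff rfl rfl, ← Complex.ofReal_pow]
        exact norm_div_sub_sub_ite_le hN1 (norm_pow_le_one_or_sq_le (hroots z hz) N)
    _ < 1 / 2 := by
        rw [mul_one_div, div_lt_div_iff₀ (sub_pos.mpr hN1) two_pos]
        linarith

end Approximation

section RootCount

open Classical in
theorem countP_roots_iterate_graeffe (p : ℝ[X]) (h : ℕ) :
    (graeffe^[h] (p.map (algebraMap ℝ ℂ))).roots.countP (‖·‖ ≤ 1) = rootCount p 0 1 := by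
  rw [roots_iterate_graeffe, Multiset.countP_map, ← Multiset.countP_eq_card_filter, rootCount]
  refine Multiset.countP_congr rfl fun z _ => propext ?_
  rw [norm_pow, pow_le_one_iff_of_nonneg (norm_nonneg z) (by positivity), mem_closedBall_zero_iff]

open Classical in
theorem rootCount_le_natDegree (p : ℝ[X]) (c : ℂ) (r : ℝ) : rootCount p c r ≤ p.natDegree := by
  rw [rootCount]
  exact (Multiset.countP_le_card _ _).trans ((card_roots' _).trans_eq (natDegree_map _))

theorem norm_le_one_or_sq_le_of_mem_roots_iterate_graeffe {γ ρ : ℝ} {h : ℕ}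
    (hp : IsIsolatedDisc p γ 0 1) (hγ : 0 ≤ γ) (hργ : ρ ^ 2 ≤ γ ^ 2 ^ h) {z : ℂ}
    (hz : z ∈ (graeffe^[h] (p.map (algebraMap ℝ ℂ))).roots) : ‖z‖ ≤ 1 ∨ ρ ^ 2 ≤ ‖z‖ := by
  rw [roots_iterate_graeffe, Multiset.mem_map] at hz
  obtain ⟨y, hy, rfl⟩ := hz
  rw [norm_pow]
  rcases le_or_gt ‖y‖ γ with hyγ | hyγ
  · have hy1 := hp y (mem_aroots'.mp hy).2 (by rwa [mul_one, mem_closedBall_zero_iff])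
    exact .inl (pow_le_one₀ (norm_nonneg y) (mem_closedBall_zero_iff.mp hy1))
  · exact .inr (hργ.trans (by gcongr))

end RootCount

section Algorithm

theorem reIm_coeffFunctions_map_subset {α : Type*} (p : α → ℝ[X]) :
    reIm (coeffFunctions fun x => (p x).map (algebraMap ℝ ℂ)) ⊆ withConsts (coeffFunctions p) := by
  rintro _ (⟨_, ⟨i, rfl⟩, rfl⟩ | ⟨_, ⟨i, rfl⟩, rfl⟩)
  · exact subset_withConsts ⟨i, funext fun x => by simp⟩
  · exact Or.inr ⟨0, funext fun x => by simp⟩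

theorem straightLine_re_cauchySum_iterate_graeffe {α : Type*} {p : α → ℝ[X]} {k N h : ℕ} {v r : ℂ}
    (hp : ∀ x, (p x).natDegree < 2 ^ k) (hN : N ≠ 0)
    (h0 : ∀ x, ∀ j < N, (graeffe^[h] ((p x).map (algebraMap ℝ ℂ))).eval (v ^ j * r) ≠ 0) :
    StraightLine (coeffFunctions p)
      (14 * (h * (6 * (k + 1) * 2 ^ k) + (2 ^ k + N * (4 * 2 ^ k + 3) + 1)))
      {fun x => (cauchySum N v r (graeffe^[h] ((p x).map (algebraMap ℝ ℂ)))).re} := by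
  have hp' (x : α) : ((p x).map (algebraMap ℝ ℂ)).natDegree < 2 ^ k :=
    natDegree_map_le.trans_lt (hp x)
  have hcauchySum := (straightLine_coeffFunctions_iterate_graeffe
    (Complex.isPrimitiveRoot_exp _ (by positivity)) hp' h).comp (straightLine_cauchySum
      (fun x => (natDegree_iterate_graeffe_le _ h).trans_lt (hp' x)) (Nat.cast_ne_zero.mpr hN) h0)
  refine ((straightLine_reIm hcauchySum).mono_left (reIm_coeffFunctions_map_subset p)).mono_right
    (Set.singleton_subset_iff.mpr (subset_withConsts ?_))
  rw [reIm_singleton]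
  exact Or.inl rfl

theorem stores_coeffFunctions {α : Type*} {p : α → ℝ[X]} {n : ℕ} (hp : ∀ x, (p x).natDegree ≤ n) :
    Stores (fun x => (p x).coeff) (n + 2) (coeffFunctions p) := by
  rintro _ ⟨i, rfl⟩
  refine ⟨min i (n + 1), by lia, fun x => ?_⟩
  rcases le_total i (n + 1) with hi | hi
  · rw [min_eq_left hi]
  · have hx := hp x
    change (p x).coeff (min i (n + 1)) = (p x).coeff i
    rw [min_eq_right hi, coeff_eq_zero_of_natDegree_lt (by lia),
      coeff_eq_zero_of_natDegree_lt (by lia)]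

theorem exists_compTree_rootCount {n k N h : ℕ} {ρ γ : ℝ} (hn : n < 2 ^ k) (hN : N ≠ 0)
    (hρ : 2 * n + 1 < ρ ^ N) (hγ : 0 ≤ γ) (hργ : ρ ^ 2 ≤ γ ^ 2 ^ h) :
    ∃ T : CompTree,
      T.flops ≤ 14 * (h * (6 * (k + 1) * 2 ^ k) + (2 ^ k + N * (4 * 2 ^ k + 3) + 1)) + n ∧
      T.comparisons = n ∧
      ∀ p : ℝ[X], p ≠ 0 → p.natDegree ≤ n → IsIsolatedDisc p γ 0 1 →
        T.run (fun i => p.coeff i) = some (rootCount p 0 1) := by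
  let Input := {p : ℝ[X] // p ≠ 0 ∧ p.natDegree ≤ n ∧ IsIsolatedDisc p γ 0 1}
  let q (p : Input) : ℂ[X] := graeffe^[h] (p.1.map (algebraMap ℝ ℂ))
  have hq0 (p : Input) : q p ≠ 0 := iterate_graeffe_ne_zero (map_ne_zero p.2.1) h
  have hqdeg (p : Input) : ((q p).natDegree : ℝ) ≤ n := by
    exact_mod_cast (natDegree_iterate_graeffe_le _ h).trans (natDegree_map_le.trans p.2.2.1)
  have hroots (p : Input) (z : ℂ) (hz : z ∈ (q p).roots) : ‖z‖ ≤ 1 ∨ ρ ^ 2 ≤ ‖z‖ :=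
    norm_le_one_or_sq_le_of_mem_roots_iterate_graeffe p.2.2.2 hγ hργ hz
  have hρ1 : 1 < ρ ^ N := by linarith [n.cast_nonneg (α := ℝ)]
  have : NeZero N := ⟨hN⟩
  obtain ⟨v, hv⟩ : ∃ v : ℂ, IsPrimitiveRoot v N := ⟨_, Complex.isPrimitiveRoot_exp N hN⟩
  have happrox (p : Input) : |(cauchySum N v ρ (q p)).re - rootCount p.1 0 1| < 1 / 2 := by
    have hlt := norm_cauchySum_sub_countP_lt hv (by linarith [hqdeg p]) (hq0 p) (hroots p)
    rw [countP_roots_iterate_graeffe] at hlt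
    exact (Complex.abs_re_le_norm _).trans_lt hlt
  obtain ⟨T, hflops, hcomparisons, hrun⟩ :=
    (straightLine_re_cauchySum_iterate_graeffe (p := fun p : Input => p.1)
      (fun p => p.2.2.1.trans_lt hn) hN fun p j _ => eval_pow_mul_ne_zero hv.pow_eq_one (hq0 p)
        (fun z hz => pow_ne_ofReal_pow hρ1 (hroots p z hz)) j).exists_tree_of_approx
      (stores_coeffFunctions fun p => p.2.2.1)
      (fun p => (rootCount_le_natDegree _ _ _).trans p.2.2.1) happrox
  exact ⟨T, hflops, hcomparisons, fun p hp hdeg hiso => hrun ⟨p, hp, hdeg, hiso⟩⟩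

theorem natLog_two_add_two_le {n : ℕ} (hn : 1 ≤ n) :
    (Nat.log 2 n + 2 : ℝ) ≤ 5 * Real.log (n + 1) := by
  have hn' : (1 : ℝ) ≤ n := by exact_mod_cast hn
  have hlog : Nat.log 2 n * Real.log 2 ≤ Real.log (n + 1) := by
    have hpow : (2 : ℝ) ^ Nat.log 2 n ≤ n := by
      exact_mod_cast Nat.pow_log_le_self 2 (Nat.one_le_iff_ne_zero.mp hn)
    rw [← Real.log_pow]
    exact Real.log_le_log (by positivity) (hpow.trans (by linarith))
  have hlog_two : Real.log 2 ≤ Real.log (n + 1) := Real.log_le_log two_pos (by linarith)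
  nlinarith [Real.log_two_gt_d9, (Nat.log 2 n).cast_nonneg (α := ℝ)]

theorem two_pow_succ_log_le {n : ℕ} (hn : 1 ≤ n) : 2 ^ (Nat.log 2 n + 1) ≤ 2 * n := by
  rw [pow_succ']
  exact Nat.mul_le_mul_left 2 (Nat.pow_log_le_self 2 (Nat.one_le_iff_ne_zero.mp hn))

theorem two_mul_add_one_lt_three_pow {n k : ℕ} (h : n < 2 ^ k) : (2 * n + 1 : ℝ) < 3 ^ (k + 1) := by
  have hpow : 2 ^ k ≤ 3 ^ k := Nat.pow_le_pow_left (by norm_num) k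
  have hlt : 2 * n + 1 < 3 ^ (k + 1) := by
    rw [pow_succ]
    lia
  exact_mod_cast hlt

theorem sq_three_le_rpow_pow (h : ℕ) : (3 : ℝ) ^ 2 ≤ ((9 : ℝ) ^ ((1 : ℝ) / 2 ^ h)) ^ 2 ^ h := by
  have hpow := Real.rpow_inv_natCast_pow (x := 9) (by norm_num) (pow_ne_zero h two_ne_zero)
  push_cast at hpow
  rw [one_div, hpow]
  norm_num

theorem flops_bound {n h k a : ℕ} (hn : 1 ≤ n) (hh : 1 ≤ h) (hk : 1 ≤ k) (ha : a ≤ 2 * n) :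
    14 * (h * (6 * (k + 1) * a) + (a + (k + 1) * (4 * a + 3) + 1)) + n ≤
      351 * (h * n * (k + 1)) := by
  have hhn : n ≤ h * n := Nat.le_mul_of_pos_left n hh
  calc _ ≤ 14 * (h * (6 * (k + 1) * (2 * n)) + (2 * n + (k + 1) * (4 * (2 * n) + 3) + 1)) + n := by
        gcongr
    _ ≤ 351 * (h * n * (k + 1)) := by nlinarith

end Algorithm

/-- Input: register `i` initially holds the coefficient of `x ^ i` (and `0` for `i > n`). -/
theorem corollaryD1 :
    ∃ C : ℝ, ∀ n h : ℕ, 1 ≤ n → 1 ≤ h →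
      ∃ T : CompTree,
        (T.flops : ℝ) ≤ C * (h * n * Real.log (n + 1)) ∧
        (T.comparisons : ℝ) ≤ C * n ∧
        ∀ p : Polynomial ℝ, p.degree = n →
          IsIsolatedDisc p ((9 : ℝ) ^ ((1 : ℝ) / 2 ^ h)) 0 1 →
          T.run (fun i => p.coeff i) = some (rootCount p 0 1) := by
  refine ⟨1755, fun n h hn hh => ?_⟩
  set k := Nat.log 2 n + 1 with hk
  have hnk : n < 2 ^ k := Nat.lt_pow_succ_log_self one_lt_two n
  have hkn : 2 ^ k ≤ 2 * n := two_pow_succ_log_le hn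
  have hlog : (k + 1 : ℝ) ≤ 5 * Real.log (n + 1) := by
    rw [hk, Nat.cast_succ, add_assoc, one_add_one_eq_two]
    exact natLog_two_add_two_le hn
  obtain ⟨T, hflops, hcomparisons, hrun⟩ := exists_compTree_rootCount hnk k.succ_ne_zero
    (two_mul_add_one_lt_three_pow hnk) (by positivity) (sq_three_le_rpow_pow h)
  refine ⟨T, ?_, ?_, fun p hp => hrun p ?_ (natDegree_eq_of_degree_eq_some hp).le⟩
  · calc (T.flops : ℝ) ≤ 351 * (h * n * (k + 1)) := by
          exact_mod_cast hflops.trans (flops_bound hn hh (Nat.le_add_left 1 _) hkn)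
      _ ≤ 351 * (h * n * (5 * Real.log (n + 1))) := by gcongr
      _ = 1755 * (h * n * Real.log (n + 1)) := by ring
  · rw [hcomparisons]
    exact le_mul_of_one_le_left n.cast_nonneg (by norm_num)
  · rintro rfl
    exact WithBot.bot_ne_coe hp
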